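/- Let $d$ be a prime number. Regard vectors in $\mathbb{C}^d$ as functions on $\mathbb{Z}_d=\mathbb{Z}/d\mathbb{Z}$. For $f,g\in\mathbb{C}^d$ define the Fourier transform and the short-time Fourier transform by $$\hat f_l=\sum_{j\in\mathbb{Z}_d} f_j\,e^{-2\pi i jl/d},\qquad V_gf(k,l)=\sum_{j\in\mathbb{Z}_d} f_j\,\overline{g_{j-k}}\,e^{-2\pi i jl/d}\qquad(k,l\in\mathbb{Z}_d).$$ A signal $f\in\mathbb{C}^d$ is called *phase retrievable* with respect to a window $g\in\mathbb{C}^d$ if every $\tilde f\in\mathbb{C}^d$ with $|V_g\tilde f|=|V_gf|$ on $\mathbb{Z}_d\times\mathbb{Z}_d$ is of the form $\tilde f=\gamma f$ with $\gamma\in\mathbb{C}$, $|\gamma|=1$. Two windows $g_1,g_2\in\mathbb{C}^d$ *do strong two-window phase retrieval* if every $f\in\mathbb{C}^d$ is phase retrievable with respect to at least one of $g_1$, $g_2$. Let $m\ge 0$ be an integer and let $g\in\mathbb{C}^d$ be such that $$\{(k,l)\in\mathbb{Z}_d\times\mathbb{Z}_d : V_gg(k,l)\neq 0\}=\{-m,\dots,m\}\times\mathbb{Z}_d,$$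 where $\{-m,\dots,m\}$ denotes the set of residue classes modulo $d$ of the integers $j$ with $-m\le j\le m$. Then the pair $(g,\hat g)$ does strong two-window phase retrieval if and only if $m>\frac{d-1}{4}$. -/

import Mathlib

/-- The short-time Fourier transform of the signal `f` with respect to the window `g`,
`V_g f (k, l) = ∑ j, f_j * conj (g_{j - k}) * exp (-2 π i j l / d)`.
Here `ZMod.stdAddChar` is the character `j mod d ↦ exp (2 π i j / d)`. -/
noncomputable def stft {d : ℕ} [NeZero d] (g f : ZMod d → ℂ) (p : ZMod d × ZMod d) : ℂ :=
  ∑ j : ZMod d, f j * starRingEnd ℂ (g (j - p.1)) * ZMod.stdAddChar (-(j * p.2))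

/-- The set `{k₁, …, k₂}` of residue classes modulo `d` of the integers from `k₁` to `k₂`. -/
def indexRange (d : ℕ) (k₁ k₂ : ℤ) : Set (ZMod d) :=
  (fun j : ℤ => (j : ZMod d)) '' Set.Icc k₁ k₂

/-- The signal `f` is phase retrievable with respect to the window `g`: it is determined by
`|V_g f|` up to a global phase factor. -/
def IsPhaseRetrievable {d : ℕ} [NeZero d] (g f : ZMod d → ℂ) : Prop :=
  ∀ f' : ZMod d → ℂ, (∀ p : ZMod d × ZMod d, ‖stft g f' p‖ = ‖stft g f p‖) →
    ∃ γ : ℂ, ‖γ‖ = 1 ∧ f' = γ • f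

/-- The windows `g₁, g₂` do strong two-window phase retrieval: every signal is phase retrievable
with respect to at least one of them. -/
def DoStrongTwoWindowPhaseRetrieval {d : ℕ} [NeZero d] (g₁ g₂ : ZMod d → ℂ) : Prop :=
  ∀ f : ZMod d → ℂ, IsPhaseRetrievable g₁ f ∨ IsPhaseRetrievable g₂ f

/-! The Fourier transform of `|V_g f|²` is a product of ambiguity functions, so `|V_g f|` fixes `f_j
* conj f_{j-a}` for all shifts `a` in the strip `{-m..m}`. Fourier covariance of the STFT turns the
two-window condition into: for each `f`, `f` or its transform is retrievable with respect to `g`.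

If `f` fails, its support splits into two parts whose differences avoid the strip, and
Cauchy–Davenport gives `|supp f| ≤ d - 2m`. If the transform fails too, the uncertainty principle
forces `d + 1 ≤ 2(d - 2m)`, that is `4m + 1 ≤ d`.

Conversely, if `4m + 1 ≤ d`, the extremal case of the uncertainty principle provides an `f` such
that `0` is isolated in both supports; flipping the sign of the value there is invisible to `g`. -/

/-! ### Uncertainty principle over cyclic groups of prime order -/

open Polynomial in
/-- Over a field of characteristic `p`, a nonzero polynomial of degree less than `p` with `s`
nonzero coefficients vanishes at `1` to order less than `s`. -/
theorem Polynomial.lt_card_support_of_X_sub_one_pow_dvd {k : Type*} [Field k] {p : ℕ} [CharP k p]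
    (n : ℕ) (P : k[X]) (hP : P ≠ 0) (hdeg : P.natDegree < p) (hdvd : (X - 1) ^ n ∣ P) :
    n < P.support.card := by
  induction n generalizing P with
  | zero => simpa [Finset.card_pos, Finset.nonempty_iff_ne_empty] using hP
  | succ n ih =>
    obtain ⟨j, hj⟩ : P.support.Nonempty := by simpa [Finset.nonempty_iff_ne_empty] using hP
    have hlt : ∀ i ∈ P.support, i < p := fun i hi =>
      (le_natDegree_of_mem_supp i hi).trans_lt hdeg
    have hinj : ∀ i ∈ P.support, (i : k) = j → i = j := fun i hi h =>
      Nat.ModEq.eq_of_lt_of_lt ((CharP.cast_eq_iff_mod_eq k p).1 h) (hlt i hi) (hlt j hj)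
    -- `X d/dX - j` kills the coefficient of `X^j` and costs only one order of vanishing at `1`.
    set Q : k[X] := X * derivative P - C (j : k) * P with hQ
    have hcoeff : ∀ i, Q.coeff i = ((i : k) - j) * P.coeff i := by
      intro i
      cases i with
      | zero => simp [hQ]
      | succ i => simp [hQ, coeff_X_mul, coeff_derivative]; ring
    have hQdvd : (X - 1) ^ n ∣ Q :=
      dvd_sub ((pow_sub_one_dvd_derivative_of_pow_dvd hdvd).mul_left _)
        (((pow_dvd_pow _ n.le_succ).trans hdvd).mul_left _)
    have hsupp : Q.support ⊆ P.support.erase j := by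
      intro i hi
      rw [mem_support_iff, hcoeff] at hi
      refine Finset.mem_erase.2 ⟨?_, mem_support_iff.2 (right_ne_zero_of_mul hi)⟩
      rintro rfl
      simp at hi
    by_cases hQ0 : Q = 0
    · have hPj : P = C (P.coeff j) * X ^ j := by
        ext i
        rw [coeff_C_mul_X_pow]
        split_ifs with h
        · rw [h]
        · by_contra hne
          have h0 := hcoeff i
          rw [hQ0, coeff_zero, eq_comm, mul_eq_zero] at h0
          exact h (hinj i (mem_support_iff.2 hne) (sub_eq_zero.1 (h0.resolve_right hne)))
      have h1 : (X - C 1) ∣ P := by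
        simpa using (dvd_pow_self (X - 1 : k[X]) n.succ_ne_zero).trans hdvd
      rw [dvd_iff_isRoot, IsRoot, hPj] at h1
      simp only [eval_mul, eval_C, eval_pow, eval_X, one_pow, mul_one] at h1
      exact absurd h1 (mem_support_iff.1 hj)
    · have hdegQ : Q.natDegree < p :=
        hlt _ (Finset.mem_of_mem_erase (hsupp (natDegree_mem_support_of_nonzero hQ0)))
      have h1 := ih Q hQ0 hdegQ hQdvd
      have h2 := Finset.card_le_card hsupp
      rw [Finset.card_erase_of_mem hj] at h2
      omega

/-- There is a valuation subring of a field of characteristic zero whose maximal ideal contains a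
given prime number. -/
theorem ValuationSubring.exists_natCast_mem_nonunits (K : Type*) [Field K] [CharZero K] (p : ℕ)
    [hp : Fact p.Prime] : ∃ V : ValuationSubring K, (p : K) ∈ V.nonunits := by
  have hI : Ideal.span {(p : (⊥ : Subring K))} ≠ ⊤ := by
    rw [Ne, Ideal.span_singleton_eq_top, isUnit_iff_exists_inv]
    rintro ⟨⟨b, hb⟩, h⟩
    obtain ⟨n, rfl⟩ := Subring.mem_bot.1 hb
    have h1 : ((p * n : ℤ) : K) = (1 : ℤ) := by
      simpa using congrArg Subtype.val h
    have h2 := Int.cast_injective h1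
    exact hp.out.one_lt.ne' (by simpa using Int.isUnit_iff.1 (.of_mul_eq_one _ h2))
  obtain ⟨V, -, hV⟩ := Ideal.image_subset_nonunits_valuationSubring _ hI
  exact ⟨V, hV ⟨p, Ideal.mem_span_singleton_self _, by simp⟩⟩

open Polynomial in
/-- **Uncertainty principle** on a cyclic group of prime order: the supports of a nonzero function
and of its Fourier transform together have more than `p` elements. -/
theorem ZMod.lt_card_support_add_card_support_dft {p : ℕ} [hp : Fact p.Prime] (f : ZMod p → ℂ)
    (hf : f ≠ 0) :
    p < (Finset.univ.filter fun j => f j ≠ 0).card +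
      (Finset.univ.filter fun l => ZMod.dft f l ≠ 0).card := by
  obtain ⟨V, hV⟩ := ValuationSubring.exists_natCast_mem_nonunits ℂ p
  have hp0 : (p : IsLocalRing.ResidueField V) = 0 := by
    rw [← map_natCast (IsLocalRing.residue V), IsLocalRing.residue_eq_zero_iff,
      ← ValuationSubring.coe_mem_nonunits_iff]
    simpa using hV
  have hchar : CharP (IsLocalRing.ResidueField V) p := by
    obtain ⟨q, hq⟩ := CharP.exists (IsLocalRing.ResidueField V)
    rcases (Nat.dvd_prime hp.out).1 ((CharP.cast_eq_zero_iff _ q p).1 hp0) with h | h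
    · exact absurd h (CharP.char_ne_one (IsLocalRing.ResidueField V) q)
    · rwa [← h]
  have hχ : ∀ j : ZMod p, (ZMod.stdAddChar j : ℂ) ^ p = 1 := by
    intro j
    rw [← AddChar.map_nsmul_eq_pow]
    simp
  have hχV : ∀ j : ZMod p, (ZMod.stdAddChar j : ℂ) ∈ V := by
    intro j
    rw [← V.valuation_le_one_iff]
    have h := congrArg V.valuation (hχ j)
    rw [map_pow, map_one] at h
    exact ((pow_eq_one_iff.1 h).resolve_right hp.out.ne_zero).le
  -- Dividing by a value of maximal valuation makes `f` integral, with nonzero reduction.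
  obtain ⟨j₀, hj₀⟩ := Finite.exists_max fun j => V.valuation (f j)
  have hfj₀ : f j₀ ≠ 0 := by
    intro h
    refine hf (funext fun j => ?_)
    simpa [h] using hj₀ j
  have hFV : ∀ j, f j / f j₀ ∈ V := by
    intro j
    rw [← V.valuation_le_one_iff, map_div₀]
    exact div_le_one_of_le₀ (hj₀ j) zero_le
  let F : ZMod p → V := fun j => ⟨f j / f j₀, hFV j⟩
  let z : ZMod p → V := fun l => ⟨ZMod.stdAddChar (-l), hχV _⟩
  have hz : Function.Injective z := by
    intro a b h
    have h' : (ZMod.stdAddChar (-a) : ℂ) = ZMod.stdAddChar (-b) := by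
      have := congrArg (fun x : V => (x : ℂ)) h
      exact this
    exact neg_injective (ZMod.injective_stdAddChar h')
  -- In residue characteristic `p`, `x^p - 1 = (x - 1)^p`: all zeros of the transform collapse to
  -- one multiple root at `1`.
  have hzres : ∀ l, IsLocalRing.residue V (z l) = 1 := by
    intro l
    have h1 : z l ^ p = 1 := Subtype.ext (by simpa using hχ (-l))
    have h2 := congrArg (IsLocalRing.residue V) h1
    rw [map_pow, map_one] at h2
    have h3 : (IsLocalRing.residue V (z l) - 1) ^ p = 0 := by
      rw [sub_pow_char, h2, one_pow, sub_self]
    exact sub_eq_zero.1 (pow_eq_zero_iff hp.out.ne_zero |>.1 h3)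
  let P : V[X] := ∑ j, C (F j) * X ^ j.val
  have hcoeff : ∀ j : ZMod p, P.coeff j.val = F j := by
    intro j
    simp [P, (ZMod.val_injective p).eq_iff]
  have hexists : ∀ i, P.coeff i ≠ 0 → ∃ j : ZMod p, i = j.val ∧ f j ≠ 0 := by
    intro i hi
    simp only [P, finsetSum_coeff] at hi
    obtain ⟨j, -, hj⟩ := Finset.exists_ne_zero_of_sum_ne_zero hi
    rw [coeff_C_mul_X_pow] at hj
    split_ifs at hj with h
    · refine ⟨j, h, fun h0 => hj (Subtype.ext ?_)⟩
      simp [F, h0]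
    · exact absurd rfl hj
  set Pk := P.map (IsLocalRing.residue V) with hPk
  have hPkcoeff : Pk.coeff j₀.val = 1 := by
    have : F j₀ = 1 := Subtype.ext (div_self hfj₀)
    rw [hPk, coeff_map, hcoeff, this, map_one]
  have hPk0 : Pk ≠ 0 := by
    intro h
    simp [h] at hPkcoeff
  have hP0 : P ≠ 0 := by
    intro h
    simp [hPk, h] at hPk0
  have hsupp : Pk.support ⊆ (Finset.univ.filter fun j => f j ≠ 0).image ZMod.val := by
    intro i hi
    rw [mem_support_iff, hPk, coeff_map] at hi
    obtain ⟨j, rfl, hj⟩ := hexists i fun h => hi (by rw [h, map_zero])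
    exact Finset.mem_image_of_mem _ (by simpa using hj)
  have hdeg : Pk.natDegree < p := by
    obtain ⟨j, -, hj⟩ := Finset.mem_image.1 (hsupp (natDegree_mem_support_of_nonzero hPk0))
    rw [← hj]
    exact ZMod.val_lt j
  set S := Finset.univ.filter fun l => ZMod.dft f l = 0 with hS
  have hroot : ∀ l ∈ S, P.IsRoot (z l) := by
    intro l hl
    have hl' : ZMod.dft f l = 0 := by simpa [hS] using hl
    refine Subtype.ext ?_
    rw [ZMod.dft_apply] at hl'
    simp only [P, eval_finsetSum, eval_mul, eval_C, eval_pow, eval_X]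
    push_cast
    have : ∀ j : ZMod p, (F j : ℂ) * (z l : ℂ) ^ j.val =
        (ZMod.stdAddChar (-(j * l)) • f j) / f j₀ := by
      intro j
      have hjl : j.val • (-l) = -(j * l) := by simp
      simp only [F, z, ← AddChar.map_nsmul_eq_pow, hjl, smul_eq_mul]
      ring
    simp only [this, ← Finset.sum_div, hl', zero_div]
  have hdvd : (∏ l ∈ S, (X - C (z l))) ∣ P := by
    have := (Multiset.prod_X_sub_C_dvd_iff_le_roots hP0 (S.val.map z)).2 ?_
    · rwa [Multiset.map_map] at this
    · rw [Multiset.le_iff_subset (S.nodup.map hz)]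
      intro x hx
      obtain ⟨l, hl, rfl⟩ := Multiset.mem_map.1 hx
      exact (mem_roots hP0).2 (hroot l hl)
  have hdvdk : (X - 1) ^ S.card ∣ Pk := by
    have h := Polynomial.map_dvd (IsLocalRing.residue V) hdvd
    have hl : ∀ l ∈ S, (X - C (z l)).map (IsLocalRing.residue V) = X - 1 := fun l _ => by
      rw [Polynomial.map_sub, map_X, map_C, hzres, C_1]
    rwa [Polynomial.map_prod, Finset.prod_congr rfl hl, Finset.prod_const] at h
  have h1 := Polynomial.lt_card_support_of_X_sub_one_pow_dvd _ Pk hPk0 hdeg hdvdk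
  have h2 := (Finset.card_le_card hsupp).trans Finset.card_image_le
  have h3 := Finset.card_filter_add_card_filter_not (s := (Finset.univ : Finset (ZMod p)))
    (fun l => ZMod.dft f l = 0)
  rw [Finset.card_univ, ZMod.card, ← hS] at h3
  change _ < _ + (Finset.univ.filter fun l => ¬ ZMod.dft f l = 0).card
  omega

theorem ZMod.sum_stdAddChar_mul {d : ℕ} [NeZero d] (t : ZMod d) :
    ∑ i : ZMod d, (ZMod.stdAddChar (i * t) : ℂ) = if t = 0 then (d : ℂ) else 0 := by
  rw [AddChar.sum_mulShift t (ZMod.isPrimitive_stdAddChar d), ZMod.card]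
  split_ifs <;> simp

theorem ZMod.conj_stdAddChar {d : ℕ} [NeZero d] (t : ZMod d) :
    starRingEnd ℂ (ZMod.stdAddChar t) = ZMod.stdAddChar (-t) :=
  (AddChar.map_neg_eq_conj _ t).symm

/-! ### Ambiguity functions and Fourier covariance -/

section stft

variable {d : ℕ} [NeZero d]

theorem stft_eq_dft (g f : ZMod d → ℂ) (k l : ZMod d) :
    stft g f (k, l) = ZMod.dft (fun j => f j * starRingEnd ℂ (g (j - k))) l := by
  simp only [stft, ZMod.dft_apply, smul_eq_mul, mul_comm]

/-- A row of the short-time Fourier transform determines the windowed signal. -/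
theorem mul_conj_eq_of_stft_eq {g f g' f' : ZMod d → ℂ} {k : ZMod d}
    (h : ∀ l, stft g f (k, l) = stft g' f' (k, l)) (j : ZMod d) :
    f j * starRingEnd ℂ (g (j - k)) = f' j * starRingEnd ℂ (g' (j - k)) := by
  simp only [stft_eq_dft] at h
  exact congrFun (ZMod.dft.injective (funext h)) j

theorem sum_stft_mul_conj_stft_mul_stdAddChar (g f : ZMod d → ℂ) (k a : ZMod d) :
    ∑ l, stft g f (k, l) * starRingEnd ℂ (stft g f (k, l)) * ZMod.stdAddChar (l * a) =
      d * ∑ j, f j * starRingEnd ℂ (f (j - a)) * (starRingEnd ℂ (g (j - k)) * g (j - k - a)) := by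
  have h1 : ∀ l, stft g f (k, l) * starRingEnd ℂ (stft g f (k, l)) * ZMod.stdAddChar (l * a) =
      ∑ j, ∑ i, f j * starRingEnd ℂ (f i) * (starRingEnd ℂ (g (j - k)) * g (i - k)) *
        ZMod.stdAddChar (l * (i - (j - a))) := by
    intro l
    simp only [stft, map_sum, map_mul, Complex.conj_conj, ZMod.conj_stdAddChar]
    rw [Finset.sum_mul_sum, Finset.sum_mul]
    refine Finset.sum_congr rfl fun j _ => ?_
    rw [Finset.sum_mul]
    refine Finset.sum_congr rfl fun i _ => ?_
    have : l * (i - (j - a)) = -(j * l) + -(-(i * l)) + l * a := by ring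
    rw [this, AddChar.map_add_eq_mul, AddChar.map_add_eq_mul]
    ring
  rw [Finset.sum_congr rfl fun l _ => h1 l, Finset.sum_comm, Finset.mul_sum]
  refine Finset.sum_congr rfl fun j _ => ?_
  rw [Finset.sum_comm]
  simp only [← Finset.mul_sum, ZMod.sum_stdAddChar_mul, sub_eq_zero, mul_ite, mul_zero,
    Finset.sum_ite_eq', Finset.mem_univ, if_true]
  rw [sub_right_comm j a k]
  ring

/-- The Fourier transform of the spectrogram is the product of the ambiguity functions. -/
theorem sum_sum_stft_mul_conj_stft_mul_stdAddChar (g f : ZMod d → ℂ) (a b : ZMod d) :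
    ∑ k, (∑ l, stft g f (k, l) * starRingEnd ℂ (stft g f (k, l)) * ZMod.stdAddChar (l * a)) *
      ZMod.stdAddChar (-(k * b)) = d * (stft f f (a, b) * starRingEnd ℂ (stft g g (a, b))) := by
  simp only [sum_stft_mul_conj_stft_mul_stdAddChar, mul_assoc (d : ℂ), ← Finset.mul_sum,
    Finset.sum_mul]
  congr 1
  rw [Finset.sum_comm]
  simp only [stft, map_sum, map_mul, Complex.conj_conj, ZMod.conj_stdAddChar]
  rw [Finset.sum_mul]
  refine Finset.sum_congr rfl fun j _ => ?_
  -- Substituting `s = j - k` decouples the double sum.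
  rw [Finset.mul_sum, ← Equiv.sum_comp (Equiv.subLeft j)]
  refine Finset.sum_congr rfl fun s _ => ?_
  have h : -((j - s) * b) = -(j * b) + - -(s * b) := by ring
  simp only [Equiv.subLeft_apply, sub_sub_cancel, h, AddChar.map_add_eq_mul]
  ring

/-- Signals with the same spectrogram have the same correlations at every shift at which the
ambiguity function of the window has no zero. -/
theorem mul_conj_eq_of_norm_stft_eq {g f f' : ZMod d → ℂ}
    (h : ∀ p, ‖stft g f' p‖ = ‖stft g f p‖) {a : ZMod d} (ha : ∀ b, stft g g (a, b) ≠ 0)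
    (j : ZMod d) : f' j * starRingEnd ℂ (f' (j - a)) = f j * starRingEnd ℂ (f (j - a)) := by
  refine mul_conj_eq_of_stft_eq (fun b => ?_) j
  have h1 : ∀ p, stft g f' p * starRingEnd ℂ (stft g f' p) =
      stft g f p * starRingEnd ℂ (stft g f p) := by
    intro p
    rw [Complex.mul_conj, Complex.mul_conj, Complex.normSq_eq_norm_sq, Complex.normSq_eq_norm_sq, h]
  have h2 := sum_sum_stft_mul_conj_stft_mul_stdAddChar g f' a b
  simp only [h1] at h2
  rw [sum_sum_stft_mul_conj_stft_mul_stdAddChar] at h2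
  have h3 := mul_left_cancel₀ (NeZero.ne (d : ℂ)) h2
  exact (mul_right_cancel₀ (by simpa using ha b) h3).symm

/-- Transforming both arguments rotates the time-frequency plane by a quarter turn, up to a phase
and the factor `d`. -/
theorem stft_dft_dft (g f : ZMod d → ℂ) (k l : ZMod d) :
    stft (ZMod.dft g) (ZMod.dft f) (k, l) =
      d * (ZMod.stdAddChar (-(k * l)) * stft g f (-l, k)) := by
  have h1 : ∀ j, ZMod.dft f j * starRingEnd ℂ (ZMod.dft g (j - k)) * ZMod.stdAddChar (-(j * l)) =
      ∑ s, ∑ t, f s * starRingEnd ℂ (g t) * ZMod.stdAddChar (-(k * t)) *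
        ZMod.stdAddChar (j * (t - (s + l))) := by
    intro j
    simp only [ZMod.dft_apply, smul_eq_mul, map_sum, map_mul, ZMod.conj_stdAddChar]
    rw [Finset.sum_mul_sum, Finset.sum_mul]
    refine Finset.sum_congr rfl fun s _ => ?_
    rw [Finset.sum_mul]
    refine Finset.sum_congr rfl fun t _ => ?_
    have e1 : j * (t - (s + l)) = j * t + (-(s * j) + -(j * l)) := by ring
    have e2 : - -(t * (j - k)) = j * t + -(k * t) := by ring
    rw [e1, e2]
    simp only [AddChar.map_add_eq_mul]
    ring
  rw [stft, Finset.sum_congr rfl fun j _ => h1 j, Finset.sum_comm, stft, Finset.mul_sum,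
    Finset.mul_sum]
  refine Finset.sum_congr rfl fun s _ => ?_
  rw [Finset.sum_comm]
  simp only [← Finset.mul_sum, ZMod.sum_stdAddChar_mul, sub_eq_zero, mul_ite, mul_zero,
    Finset.sum_ite_eq', Finset.mem_univ, if_true]
  have e : -(k * (s + l)) = -(k * l) + -(s * k) := by ring
  rw [e, AddChar.map_add_eq_mul, sub_neg_eq_add]
  ring

theorem isPhaseRetrievable_dft_dft {g f : ZMod d → ℂ} :
    IsPhaseRetrievable (ZMod.dft g) (ZMod.dft f) ↔ IsPhaseRetrievable g f := by
  have hnorm : ∀ f : ZMod d → ℂ, ∀ k l : ZMod d,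
      ‖stft (ZMod.dft g) (ZMod.dft f) (k, l)‖ = d * ‖stft g f (-l, k)‖ := by
    intro f k l
    rw [stft_dft_dft, norm_mul, norm_mul, AddChar.norm_apply, one_mul, Complex.norm_natCast]
  have hiff : ∀ f' : ZMod d → ℂ, (∀ p, ‖stft (ZMod.dft g) (ZMod.dft f') p‖ =
      ‖stft (ZMod.dft g) (ZMod.dft f) p‖) ↔ ∀ p, ‖stft g f' p‖ = ‖stft g f p‖ := by
    intro f'
    simp only [Prod.forall, hnorm, mul_right_inj' (NeZero.ne (d : ℝ))]
    exact ⟨fun h k l => by simpa using h l (-k), fun h k l => h _ _⟩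
  unfold IsPhaseRetrievable
  rw [← ZMod.dft.toEquiv.forall_congr_right]
  refine forall_congr' fun f' => ?_
  simp only [LinearEquiv.coe_toEquiv, hiff, ← map_smul, ZMod.dft.injective.eq_iff]

theorem doStrongTwoWindowPhaseRetrieval_dft_iff {g : ZMod d → ℂ} :
    DoStrongTwoWindowPhaseRetrieval g (ZMod.dft g) ↔
      ∀ f, IsPhaseRetrievable g (ZMod.dft f) ∨ IsPhaseRetrievable g f := by
  unfold DoStrongTwoWindowPhaseRetrieval
  rw [← ZMod.dft.toEquiv.forall_congr_right]
  simp only [LinearEquiv.coe_toEquiv, isPhaseRetrievable_dft_dft]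

end stft

/-! ### Non-retrievable signals have small support -/

theorem mem_indexRange_neg_of_le {d m : ℕ} [NeZero d] (h : d ≤ 2 * m + 1) (x : ZMod d) :
    x ∈ indexRange d (-(m : ℤ)) m := by
  have hx := ZMod.natAbs_valMinAbs_le x
  exact ⟨x.valMinAbs, Set.mem_Icc.2 (by omega), ZMod.coe_valMinAbs x⟩

theorem ncard_indexRange_neg {d m : ℕ} (h : 2 * m + 1 ≤ d) :
    (indexRange d (-(m : ℤ)) m).ncard = 2 * m + 1 := by
  rw [indexRange, Set.InjOn.ncard_image, ← Finset.coe_Icc, Set.ncard_coe_finset, Int.card_Icc]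
  · omega
  · intro a ha b hb hab
    rw [Set.mem_Icc] at ha hb
    have h1 : ((a - b : ℤ) : ZMod d) = 0 := by
      rw [Int.cast_sub, sub_eq_zero]
      exact hab
    have h2 := (ZMod.intCast_zmod_eq_zero_iff_dvd _ d).1 h1
    have h3 := Int.eq_zero_of_abs_lt_dvd h2 (by rw [abs_lt]; omega)
    omega

theorem zero_mem_indexRange_neg (d m : ℕ) : (0 : ZMod d) ∈ indexRange d (-(m : ℤ)) m :=
  ⟨0, Set.mem_Icc.2 (by omega), Int.cast_zero⟩

open scoped Pointwise in
/-- A signal that is not phase retrievable with respect to a window whose ambiguity function has no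
zero on a strip is nonzero and has a small support. -/
theorem card_support_le_of_not_isPhaseRetrievable {d : ℕ} [Fact d.Prime] {m : ℕ}
    {g f : ZMod d → ℂ} (hg : ∀ a ∈ indexRange d (-(m : ℤ)) m, ∀ b, stft g g (a, b) ≠ 0)
    (hf : ¬ IsPhaseRetrievable g f) :
    f ≠ 0 ∧ 2 * m + (Finset.univ.filter fun j => f j ≠ 0).card ≤ d := by
  classical
  unfold IsPhaseRetrievable at hf
  push Not at hf
  obtain ⟨f', hff', hne⟩ := hf
  have key := fun a ha j => mul_conj_eq_of_norm_stft_eq hff' (hg a ha) j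
  have hnorm : ∀ j, ‖f' j‖ = ‖f j‖ := by
    intro j
    have h := congrArg norm (key 0 (zero_mem_indexRange_neg d m) j)
    simp only [sub_zero, norm_mul, RCLike.norm_conj] at h
    exact (mul_self_inj (norm_nonneg _) (norm_nonneg _)).1 h
  obtain ⟨j₀, hj₀⟩ : ∃ j, f j ≠ 0 := by
    by_contra! h0
    refine hne 1 norm_one (funext fun j => ?_)
    have h := hnorm j
    rw [h0 j, norm_zero, norm_eq_zero] at h
    simp [h, h0 j]
  refine ⟨fun h0 => hj₀ (congrFun h0 j₀), ?_⟩
  set γ := f' j₀ / f j₀ with hγ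
  have hγ1 : ‖γ‖ = 1 := by
    rw [hγ, norm_div, hnorm, div_self (norm_ne_zero_iff.2 hj₀)]
  have hγc : γ * starRingEnd ℂ γ = 1 := by
    rw [Complex.mul_conj, Complex.normSq_eq_norm_sq, hγ1]
    simp
  set S := Finset.univ.filter fun j => f j ≠ 0 with hS
  set S₁ := S.filter fun j => f' j = γ * f j with hS₁
  set S₂ := S.filter fun j => ¬ f' j = γ * f j with hS₂
  have hcard : S₁.card + S₂.card = S.card := Finset.card_filter_add_card_filter_not _
  have hne₁ : S₁.Nonempty := ⟨j₀, by simp [hS₁, hS, hj₀, hγ]⟩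
  have hne₂ : S₂.Nonempty := by
    obtain ⟨j, hj⟩ := Function.ne_iff.1 (hne γ hγ1)
    refine ⟨j, ?_⟩
    simp only [hS₂, hS, Finset.mem_filter, Finset.mem_univ, true_and]
    refine ⟨fun h0 => hj ?_, hj⟩
    have h := hnorm j
    rw [h0, norm_zero, norm_eq_zero] at h
    simp [h, h0]
  -- A correlation at shift `j - i` would carry the phase `γ` from `i` to `j`.
  have hsep : ∀ j ∈ S₂, ∀ i ∈ S₁, j - i ∉ indexRange d (-(m : ℤ)) m := by
    intro j hj i hi hR
    simp only [hS₁, hS₂, hS, Finset.mem_filter, Finset.mem_univ, true_and] at hi hj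
    have h := key _ hR j
    rw [sub_sub_cancel, hi.2, map_mul, ← mul_assoc] at h
    have h' := mul_right_cancel₀ (by simpa using hi.1) h
    apply hj.2
    rw [← h']
    linear_combination (-f' j) * hγc
  have hlt : 2 * m + 1 ≤ d := by
    by_contra! hlt
    obtain ⟨i, hi⟩ := hne₁
    obtain ⟨j, hj⟩ := hne₂
    exact hsep j hj i hi (mem_indexRange_neg_of_le hlt.le _)
  have hcd := ZMod.cauchy_davenport (Fact.out : d.Prime) hne₂ hne₁.neg
  rw [Finset.card_neg] at hcd
  have hsub : (↑(S₂ + -S₁) : Set (ZMod d)) ⊆ (indexRange d (-(m : ℤ)) m)ᶜ := by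
    intro x hx
    obtain ⟨j, hj, i, hi, rfl⟩ := Finset.mem_add.1 (Finset.mem_coe.1 hx)
    obtain ⟨i, hi', rfl⟩ := Finset.mem_neg.1 hi
    rw [← sub_eq_add_neg]
    exact hsep j hj i hi'
  have h1 := Set.ncard_le_ncard hsub
  have h2 := Set.ncard_add_ncard_compl (indexRange d (-(m : ℤ)) m)
  rw [ncard_indexRange_neg hlt, Nat.card_zmod] at h2
  rw [Set.ncard_coe_finset] at h1
  have h3 := hne₁.card_pos
  omega

/-! ### Signals that fail for both windows -/

/-- A signal whose support contains `0` and a window that cannot connect `0` to another point of it: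
the signal
is not phase retrievable. -/
theorem not_isPhaseRetrievable_of_isolated {d : ℕ} [NeZero d] {g f : ZMod d → ℂ}
    (hf : f 0 ≠ 0) {i : ZMod d} (hi : i ≠ 0) (hfi : f i ≠ 0)
    (hg : ∀ j, j ≠ 0 → f j ≠ 0 → ∀ l, stft g g (j, l) = 0) : ¬ IsPhaseRetrievable g f := by
  classical
  intro h
  have hnorm : ∀ p, ‖stft g (Function.update f 0 (-f 0)) p‖ = ‖stft g f p‖ := by
    rintro ⟨k, l⟩
    -- For each `k`, either the entry at `0` is not seen, or it is the only one seen and the whole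
    -- row changes sign.
    by_cases hk : g (-k) = 0
    · congr 1
      refine Finset.sum_congr rfl fun j _ => ?_
      rcases eq_or_ne j 0 with rfl | hj
      · simp [hk]
      · rw [Function.update_of_ne hj]
    · rw [← norm_neg (stft g f (k, l)), stft, stft, ← Finset.sum_neg_distrib]
      congr 1
      refine Finset.sum_congr rfl fun j _ => ?_
      rcases eq_or_ne j 0 with rfl | hj
      · simp
      · rw [Function.update_of_ne hj]
        by_cases hfj : f j = 0
        · simp [hfj]
        · have h := mul_conj_eq_of_stft_eq (g := g) (f := g) (g' := 0) (f' := 0) (k := j)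
            (fun l => by rw [hg j hj hfj l]; simp [stft]) (j - k)
          have h' : g (j - k) = 0 := by
            simpa [hk, sub_right_comm j k j] using h
          simp [h']
  obtain ⟨γ, -, hγ⟩ := h _ hnorm
  have h0 := congrFun hγ 0
  have h1 := congrFun hγ i
  rw [Function.update_self, Pi.smul_apply, smul_eq_mul] at h0
  rw [Function.update_of_ne hi, Pi.smul_apply, smul_eq_mul] at h1
  have e0 : γ = -1 := mul_right_cancel₀ hf (by rw [← h0]; ring)
  have e1 : γ = 1 := mul_right_cancel₀ hfi (by rw [← h1]; ring)
  rw [e0] at e1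
  norm_num at e1

/-- Sets whose sizes add up to `p + 1` are the supports of a function on a cyclic group of prime
order `p` and of its Fourier transform. -/
theorem ZMod.exists_support_eq_support_dft_eq {p : ℕ} [hp : Fact p.Prime] (A B : Finset (ZMod p))
    (h : A.card + B.card = p + 1) :
    ∃ f : ZMod p → ℂ, (∀ j, f j ≠ 0 ↔ j ∈ A) ∧ ∀ l, ZMod.dft f l ≠ 0 ↔ l ∈ B := by
  classical
  -- The target has dimension `2p - (p + 1) < p`, so some nonzero `f` vanishes off `A` while its
  -- transform vanishes off `B`.
  let T : (ZMod p → ℂ) →ₗ[ℂ] ((Aᶜ : Finset (ZMod p)) → ℂ) × ((Bᶜ : Finset (ZMod p)) → ℂ) :=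
    (LinearMap.funLeft ℂ ℂ Subtype.val).prod
      ((LinearMap.funLeft ℂ ℂ Subtype.val).comp (ZMod.dft : (ZMod p → ℂ) ≃ₗ[ℂ] _).toLinearMap)
  have hT : LinearMap.ker T ≠ ⊥ := by
    apply LinearMap.ker_ne_bot_of_finrank_lt
    rw [Module.finrank_prod, Module.finrank_fintype_fun_eq_card,
      Module.finrank_fintype_fun_eq_card, Module.finrank_fintype_fun_eq_card,
      Fintype.card_coe, Fintype.card_coe, Finset.card_compl, Finset.card_compl, ZMod.card]
    have h1 := A.card_le_univ
    have h2 := B.card_le_univ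
    rw [ZMod.card] at h1 h2
    have := hp.out.two_le
    omega
  obtain ⟨f, hfT, hf⟩ := Submodule.exists_mem_ne_zero_of_ne_bot hT
  rw [LinearMap.mem_ker] at hfT
  have hA : ∀ j, f j ≠ 0 → j ∈ A := by
    intro j hj
    by_contra hjA
    exact hj (congrFun (congrArg Prod.fst hfT) ⟨j, Finset.mem_compl.2 hjA⟩)
  have hB : ∀ l, ZMod.dft f l ≠ 0 → l ∈ B := by
    intro l hl
    by_contra hlB
    exact hl (congrFun (congrArg Prod.snd hfT) ⟨l, Finset.mem_compl.2 hlB⟩)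
  have hu := ZMod.lt_card_support_add_card_support_dft f hf
  have hA' : (Finset.univ.filter fun j => f j ≠ 0) ⊆ A := fun j hj => hA j (by simpa using hj)
  have hB' : (Finset.univ.filter fun l => ZMod.dft f l ≠ 0) ⊆ B :=
    fun l hl => hB l (by simpa using hl)
  have hAc := Finset.card_le_card hA'
  have hBc := Finset.card_le_card hB'
  have hAe := Finset.eq_of_subset_of_card_le hA' (by omega)
  have hBe := Finset.eq_of_subset_of_card_le hB' (by omega)
  exact ⟨f, fun j => by simp [← hAe], fun l => by simp [← hBe]⟩

/-- If `4 * m < d`, there is a signal such that `0` is a point at distance more than `m` from the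
rest of the support, both for the signal and for its Fourier transform. -/
theorem exists_isolated_isolated_dft {d : ℕ} [hd : Fact d.Prime] {m : ℕ} (hm : 4 * m + 1 ≤ d) :
    ∃ f : ZMod d → ℂ,
      (f 0 ≠ 0 ∧ (∃ i, i ≠ 0 ∧ f i ≠ 0) ∧
        ∀ j, j ≠ 0 → f j ≠ 0 → j ∉ indexRange d (-(m : ℤ)) m) ∧
      (ZMod.dft f 0 ≠ 0 ∧ (∃ i, i ≠ 0 ∧ ZMod.dft f i ≠ 0) ∧
        ∀ j, j ≠ 0 → ZMod.dft f j ≠ 0 → j ∉ indexRange d (-(m : ℤ)) m) := by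
  classical
  -- For `m = 0` the set `B` below would be a single point; `δ₀ + 1` serves instead.
  rcases m.eq_zero_or_pos with rfl | hm0
  · have hR : ∀ j : ZMod d, j ≠ 0 → j ∉ indexRange d (-((0 : ℕ) : ℤ)) (0 : ℕ) := by
      intro j hj h
      simp [indexRange] at h
      exact hj h
    have hdft : ∀ l, ZMod.dft (Pi.single 0 1 + 1 : ZMod d → ℂ) l =
        1 + if l = 0 then (d : ℂ) else 0 := by
      intro l
      have h := ZMod.sum_stdAddChar_mul (-l)
      simp only [neg_eq_zero, mul_neg] at h
      rw [map_add, Pi.add_apply, ← h]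
      simp [ZMod.dft_apply, Pi.single_apply]
    refine ⟨Pi.single 0 1 + 1, ⟨?_, ⟨1, one_ne_zero, ?_⟩, fun j hj _ => hR j hj⟩,
      ⟨?_, ⟨1, one_ne_zero, ?_⟩, fun j hj _ => hR j hj⟩⟩
    · simp
    · simp
    · rw [hdft, if_pos rfl, add_comm]
      exact Nat.cast_add_one_ne_zero d
    · rw [hdft, if_neg one_ne_zero]
      simp
  · set A : Finset (ZMod d) :=
      Finset.univ.filter fun j => j = 0 ∨ j ∉ indexRange d (-(m : ℤ)) m with hA
    have h0A : (0 : ZMod d) ∈ A := by simp [hA]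
    have hAcard : A.card = d - 2 * m := by
      have h1 : (↑Aᶜ : Set (ZMod d)) = indexRange d (-(m : ℤ)) m \ {0} := by
        ext j
        simp [hA, and_comm]
      have h2 := congrArg Set.ncard h1
      rw [Set.ncard_coe_finset, Set.ncard_sdiff_singleton_of_mem (zero_mem_indexRange_neg d m),
        ncard_indexRange_neg (by omega)] at h2
      have h3 := A.card_add_card_compl
      rw [ZMod.card] at h3
      omega
    -- The size makes `|A| + |B| = d + 1`; it fits inside `A` exactly because `4m + 1 ≤ d`.
    obtain ⟨B, h0B, hBA, hBcard⟩ := Finset.exists_subsuperset_card_eq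
      (Finset.singleton_subset_iff.2 h0A) (n := 2 * m + 1) (by simp) (by omega)
    have hiso : ∀ (C : Finset (ZMod d)) (f : ZMod d → ℂ), (∀ j, f j ≠ 0 ↔ j ∈ C) → C ⊆ A → 0 ∈ C →
        1 < C.card → f 0 ≠ 0 ∧ (∃ i, i ≠ 0 ∧ f i ≠ 0) ∧
          ∀ j, j ≠ 0 → f j ≠ 0 → j ∉ indexRange d (-(m : ℤ)) m := by
      intro C f hf hCA h0 hC
      refine ⟨(hf 0).2 h0, ?_, fun j hj hfj => ?_⟩
      · obtain ⟨i, hiC, hi⟩ := Finset.exists_mem_ne hC 0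
        exact ⟨i, hi, (hf i).2 hiC⟩
      · have := hCA ((hf j).1 hfj)
        simp only [hA, Finset.mem_filter, Finset.mem_univ, true_and] at this
        exact this.resolve_left hj
    obtain ⟨f, hfA, hfB⟩ := ZMod.exists_support_eq_support_dft_eq A B (by omega)
    exact ⟨f, hiso A f hfA subset_rfl h0A (by omega),
      hiso B _ hfB hBA (Finset.singleton_subset_iff.1 h0B) (by omega)⟩

theorem mainTheorem4 (d : ℕ) [Fact d.Prime] (m : ℕ) (g : ZMod d → ℂ)
    (hg : Function.support (stft g g) = indexRange d (-(m : ℤ)) (m : ℤ) ×ˢ Set.univ) :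
    DoStrongTwoWindowPhaseRetrieval g (ZMod.dft g) ↔ (m : ℝ) > ((d : ℝ) - 1) / 4 := by
  have hmem : ∀ a b, stft g g (a, b) ≠ 0 ↔ a ∈ indexRange d (-(m : ℤ)) m := by
    intro a b
    rw [← Function.mem_support, hg]
    simp
  have hm : (m : ℝ) > ((d : ℝ) - 1) / 4 ↔ d < 4 * m + 1 := by
    rw [gt_iff_lt, div_lt_iff₀ (by norm_num), sub_lt_iff_lt_add]
    constructor <;> intro h
    · exact_mod_cast (by linarith : (d : ℝ) < 4 * m + 1)
    · have : (d : ℝ) < 4 * m + 1 := by exact_mod_cast h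
      linarith
  rw [doStrongTwoWindowPhaseRetrieval_dft_iff, hm]
  constructor
  · intro h
    by_contra! hlt
    obtain ⟨f, ⟨h0, ⟨i, hi, hfi⟩, hR⟩, ⟨h0', ⟨i', hi', hfi'⟩, hR'⟩⟩ :=
      exists_isolated_isolated_dft hlt
    refine (h f).elim (not_isPhaseRetrievable_of_isolated h0' hi' hfi' fun j hj hfj l => ?_)
      (not_isPhaseRetrievable_of_isolated h0 hi hfi fun j hj hfj l => ?_)
    · exact not_not.1 fun hne => hR' j hj hfj ((hmem j l).1 hne)
    · exact not_not.1 fun hne => hR j hj hfj ((hmem j l).1 hne)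
  · intro hlt f
    by_contra! h
    have hne : ∀ a ∈ indexRange d (-(m : ℤ)) m, ∀ b, stft g g (a, b) ≠ 0 :=
      fun a ha b => (hmem a b).2 ha
    have h1 := (card_support_le_of_not_isPhaseRetrievable hne h.1).2
    obtain ⟨hf, h2⟩ := card_support_le_of_not_isPhaseRetrievable hne h.2
    have h3 := ZMod.lt_card_support_add_card_support_dft f hf
    omega
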